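/- For $m\ge 1$ let $\mathbb S^m\subset\mathbb R^{m+1}$ be the unit sphere with its round metric. A smooth map $\phi:\mathbb S^m\to\mathbb S^N$ into a round unit sphere is harmonic if $\tau(\phi)=\operatorname{Tr}\bar\nabla d\phi=0$, and conformal biharmonic if $$\tau_2^c(\phi)=\bar\Delta\tau(\phi)+\operatorname{Tr}R^{\mathbb S^N}(\tau(\phi),d\phi(\cdot))d\phi(\cdot)+\tfrac13\big(d\phi(\nabla\operatorname{Scal})-2\operatorname{Scal}\,\tau(\phi)\big)+2\operatorname{Tr}(\bar\nabla d\phi)(\operatorname{Ric}(\cdot),\cdot)=0,$$ where $\operatorname{Ric},\operatorname{Scal}$ are the Ricci endomorphism and the scalar curvature of $\mathbb S^m$, $\bar\nabla$ is the connection on $\phi^*T\mathbb S^N$ and $\bar\Delta=\operatorname{Tr}(\bar\nabla\bar\nabla-\bar\nabla_\nabla)$. It is unstable if it has a smooth variation $\phi_t:\mathbb S^m\to\mathbb S^N$, $\phi_0=\phi$, with $\frac{d^2}{dt^2}\big|_{t=0}E_2^c(\phi_t)<0$, where $$E_2^c(\phi)=\tfrac12\int_{\mathbb S^m}\big(|\tau(\phi)|^2+\tfrac23\operatorname{Scal}|d\phi|^2-2\operatorname{Tr}\langle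 d\phi(\operatorname{Ric}(\cdot)),d\phi(\cdot)\rangle\big)\,dv.$$ A smooth map $v:\mathbb S^m\to\mathbb S^n\subset\mathbb R^{n+1}$ is an eigenmap if all its components satisfy the eigenvalue equation of the Laplace-Beltrami operator with the same eigenvalue; it is an eigenmap of degree $k\in\{0,1,2,\dots\}$ if its components are restrictions to $\mathbb S^m$ of harmonic homogeneous polynomials of degree $k$ on $\mathbb R^{m+1}$. **Theorem.** Let $m\ge1$ and $n\ge 0$. (0) A map $v:\mathbb S^m\to\mathbb S^n$ is an eigenmap if and only if it is harmonic and $|\nabla v|^2$ is constant. (1) Let $v_1,v_2:\mathbb S^m\to\mathbb S^n$ be eigenmaps with $|\nabla v_i|^2=\lambda_i$, $\lambda_1\ne\lambda_2$, and let $\beta\in(0,\frac\pi2)$ satisfy $$\cos 2\beta=\frac23(m-1)(m-3)\frac1{\lambda_2-\lambda_1}.$$ Then $w=(\sin\beta\cdot v_1,\cos\beta\cdot v_2):\mathbb S^m\to\mathbb S^{2n+1}\subset\mathbb R^{2n+2}$ is conformal biharmonic, not harmonic, and unstable. (2) Let $v_1,v_2:\mathbb S^m\to\mathbb S^n$ be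 eigenmaps of degrees $k_1,k_2$. Then they are eigenmaps with $|\nabla v_i|^2=\lambda_i=k_i(k_i+m-1)$. If $k_1\ne k_2$, then $\lambda_1\neq\lambda_2$, and an angle $\beta\in(0,\frac\pi2)$ as in (1) exists if and only if $$\frac23(m-1)(m-3)<|k_1-k_2|\,(k_1+k_2+m-1).$$ -/

import Mathlib

open scoped Manifold ContDiff
open MeasureTheory

noncomputable section

namespace SphereMaps

/-! ### The unit sphere of a Euclidean space as a Riemannian submanifold

Tangent vectors at `p`, vector fields, and sections of pull-back bundles are represented by vectors
of the ambient Euclidean space; the tangent space at `p` is the hyperplane `(ℝ ∙ p)ᗮ`. -/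

/-- The unit sphere of a normed space `E`. -/
abbrev USphere (E : Type*) [NormedAddCommGroup E] : Type _ := Metric.sphere (0 : E) 1

/-- The Euclidean space `ℝ^(m+1)`, whose unit sphere is `S^m`. -/
abbrev Euc (m : ℕ) : Type := EuclideanSpace ℝ (Fin (m + 1))

section Calculus

variable {E : Type*} [NormedAddCommGroup E] [InnerProductSpace ℝ E]
variable {F : Type*} [NormedAddCommGroup F] [InnerProductSpace ℝ F]
variable {V : Type*} [NormedAddCommGroup V] [NormedSpace ℝ V]

/-- The extension `x ↦ f (x / ‖x‖)` of a function on the unit sphere (with value `0` at `0`). -/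
def radialExt (f : USphere E → V) (x : E) : V :=
  open Classical in
  if h : x = 0 then 0
  else f ⟨‖x‖⁻¹ • x, by
    simp [norm_smul, inv_mul_cancel₀ (norm_ne_zero_iff.mpr h)]⟩

/-- The derivative `d f_p (x)` of a vector-valued function on the unit sphere
in the direction of the tangent vector `x` at `p`. -/
def dirDeriv (f : USphere E → V) (p : USphere E) (x : E) : V :=
  fderiv ℝ (radialExt f) (p : E) x

/-- Orthogonal projection onto the tangent space of the unit sphere at `q`. -/
def tangProj (q : USphere E) (a : E) : E := a - inner ℝ (q : E) a • (q : E)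

/-- The tangent vector field on the unit sphere obtained by projecting the constant vector `x`.
If `x` is tangent at `p`, then its value at `p` is `x`. Tensorial expressions at `p` are
evaluated on tangent vectors at `p` by means of these vector fields. -/
def tangField (x : E) : USphere E → E := fun q => tangProj q x

/-- The connection on the pull-back bundle `φ^* T S`: the section `∇̄_X W` along `φ`, for a tangent
vector field `X` on the domain sphere and a section `W` along `φ`. -/
def nablaAlong (φ : USphere E → USphere F) (X : USphere E → E) (W : USphere E → F) :
    USphere E → F :=
  fun p => tangProj (φ p) (dirDeriv W p (X p))

/-- The Levi-Civita connection `∇_X Y` of the unit sphere. -/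
def nabla (X Y : USphere E → E) : USphere E → E := nablaAlong id X Y

/-- The Lie bracket `[X, Y]` of tangent vector fields on the unit sphere. -/
def lieBracket (X Y : USphere E → E) : USphere E → E :=
  fun p => dirDeriv Y p (X p) - dirDeriv X p (Y p)

/-- The Riemannian curvature tensor `R(x, y)z = [∇_x, ∇_y]z - ∇_[x, y] z` of the unit sphere
at `p`, for tangent vectors `x, y, z` at `p`. -/
def curv (p : USphere E) (x y z : E) : E :=
  nabla (tangField x) (nabla (tangField y) (tangField z)) p
    - nabla (tangField y) (nabla (tangField x) (tangField z)) p
    - nabla (lieBracket (tangField x) (tangField y)) (tangField z) p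

/-- The differential `dφ_p (x)` of a map between unit spheres. -/
def differential (φ : USphere E → USphere F) (p : USphere E) (x : E) : F :=
  dirDeriv (fun q => (φ q : F)) p x

/-- The second fundamental form `(∇̄ dφ)(x, y) = ∇̄_x (dφ(y)) - dφ(∇_x y)` of a map. -/
def secondFund (φ : USphere E → USphere F) (p : USphere E) (x y : E) : F :=
  nablaAlong φ (tangField x) (fun q => differential φ q (tangField y q)) p
    - differential φ p (nabla (tangField x) (tangField y) p)

/-- The Hessian `(∇ df)(x, y) = x (y f) - (∇_x y) f` of a function on the unit sphere. -/
def hess (f : USphere E → V) (p : USphere E) (x y : E) : V :=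
  dirDeriv (fun q => dirDeriv f q (tangField y q)) p x
    - dirDeriv f p (nabla (tangField x) (tangField y) p)

variable [FiniteDimensional ℝ E]

/-- The trace, over the tangent space at `p`, of a bilinear expression `B`. -/
def tr (p : USphere E) (B : E → E → V) : V :=
  ∑ i, B (stdOrthonormalBasis ℝ (ℝ ∙ (p : E))ᗮ i) (stdOrthonormalBasis ℝ (ℝ ∙ (p : E))ᗮ i)

/-- The Ricci tensor `Ric(x, y) = Tr (z ↦ R(z, x)y)`. -/
def ric (p : USphere E) (x y : E) : ℝ :=
  tr p (fun z z' => inner ℝ (curv p z x y) z')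

/-- The Ricci tensor as an endomorphism of the tangent space,
`⟨Ric(x), y⟩ = Ric(x, y)`. -/
def ricEndo (p : USphere E) (x : E) : E :=
  tr p (fun z z' => ric p x z • z')

/-- The scalar curvature. -/
def scal (p : USphere E) : ℝ := tr p (ric p)

/-- The gradient of the scalar curvature. -/
def gradScal (p : USphere E) : E :=
  tr p (fun z z' => dirDeriv (scal : USphere E → ℝ) p z • z')

/-- The Laplace-Beltrami operator (analysts' sign: it has non-positive spectrum). -/
def laplaceBeltrami (f : USphere E → V) (p : USphere E) : V := tr p (hess f p)

/-- `|∇φ|² = |dφ|²`, twice the energy density of a map `φ`. -/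
def gradSq (φ : USphere E → USphere F) (p : USphere E) : ℝ :=
  tr p (fun x y => inner ℝ (differential φ p x) (differential φ p y))

/-- The tension field `τ(φ) = Tr ∇̄ dφ`. -/
def tension (φ : USphere E → USphere F) (p : USphere E) : F := tr p (secondFund φ p)

/-- The rough Laplacian `Δ̄ = Tr (∇̄ ∇̄ - ∇̄_∇)` on sections along `φ`. -/
def roughLaplacian (φ : USphere E → USphere F) (W : USphere E → F) (p : USphere E) : F :=
  tr p (fun x y =>
    nablaAlong φ (tangField x) (nablaAlong φ (tangField y) W) p
      - nablaAlong φ (nabla (tangField x) (tangField y)) W p)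

/-- The bitension field `τ₂(φ) = Δ̄ τ(φ) + Tr R(τ(φ), dφ(·)) dφ(·)`. -/
def bitension (φ : USphere E → USphere F) (p : USphere E) : F :=
  roughLaplacian φ (tension φ) p
    + tr p (fun x y => curv (φ p) (tension φ p) (differential φ p x) (differential φ p y))

/-- The conformal bitension field
`τ₂ᶜ(φ) = τ₂(φ) + (1/3) (dφ(∇ Scal) - 2 Scal τ(φ)) + 2 Tr (∇̄ dφ)(Ric(·), ·)`. -/
def conformalBitension (φ : USphere E → USphere F) (p : USphere E) : F :=
  bitension φ p
    + (1 / 3 : ℝ) • (differential φ p (gradScal p) - (2 * scal p) • tension φ p)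
    + (2 : ℝ) • tr p (fun x y => secondFund φ p (ricEndo p x) y)

/-- The conformal bienergy
`E₂ᶜ(φ) = (1/2) ∫ (|τ(φ)|² + (2/3) Scal |dφ|² - 2 Tr ⟨dφ(Ric(·)), dφ(·)⟩) dv`,
where `dv` is the surface measure of the unit sphere. -/
def conformalBienergy [MeasureSpace E] [BorelSpace E] (φ : USphere E → USphere F) : ℝ :=
  (1 / 2) * ∫ p, (‖tension φ p‖ ^ 2 + (2 / 3) * scal p * gradSq φ p
    - 2 * tr p (fun x y => inner ℝ (differential φ p (ricEndo p x)) (differential φ p y)))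
    ∂((volume : Measure E).toSphere)

end Calculus

section Maps

variable {m : ℕ} {F : Type*} [NormedAddCommGroup F] [InnerProductSpace ℝ F]

/-- Smoothness of a map from `S^m` to the unit sphere of `F`, as a map into the ambient space. -/
def IsSmooth (φ : USphere (Euc m) → USphere F) : Prop :=
  ContMDiff (𝓡 m) 𝓘(ℝ, F) ∞ (fun p => (φ p : F))

/-- Harmonic maps: smooth maps with vanishing tension field. -/
def IsHarmonic (φ : USphere (Euc m) → USphere F) : Prop :=
  IsSmooth φ ∧ ∀ p, tension φ p = 0

/-- Conformal biharmonic maps: smooth maps with vanishing conformal bitension field. -/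
def IsConformalBiharmonic (φ : USphere (Euc m) → USphere F) : Prop :=
  IsSmooth φ ∧ ∀ p, conformalBitension φ p = 0

/-- A map is unstable for the conformal bienergy if there is a smooth variation `Φ_t` of it,
through maps into the unit sphere, with `d²/dt² E₂ᶜ(Φ_t) < 0` at `t = 0`. -/
def IsUnstable (φ : USphere (Euc m) → USphere F) : Prop :=
  ∃ Φ : ℝ → USphere (Euc m) → USphere F,
    ContMDiff (𝓘(ℝ, ℝ).prod (𝓡 m)) 𝓘(ℝ, F) ∞
      (fun z : ℝ × USphere (Euc m) => (Φ z.1 z.2 : F)) ∧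
    Φ 0 = φ ∧
    iteratedDeriv 2 (fun t => conformalBienergy (Φ t)) 0 < 0

variable {n : ℕ}

/-- Eigenmaps `S^m → S^n`: smooth maps all of whose components satisfy the eigenvalue equation of
the Laplace-Beltrami operator with the same eigenvalue. -/
def IsEigenmap (v : USphere (Euc m) → USphere (Euc n)) : Prop :=
  IsSmooth v ∧ ∃ μ : ℝ, ∀ (j : Fin (n + 1)) (p : USphere (Euc m)),
    laplaceBeltrami (fun q => (v q : Euc n) j) p = μ * (v p : Euc n) j

/-- Eigenmaps `S^m → S^n` of degree `k`: restrictions of maps `ℝ^(m+1) → ℝ^(n+1)` whose components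
are harmonic homogeneous polynomials of degree `k`. -/
def IsEigenmapOfDegree (k : ℕ) (v : USphere (Euc m) → USphere (Euc n)) : Prop :=
  ∃ P : Fin (n + 1) → MvPolynomial (Fin (m + 1)) ℝ,
    (∀ j, (P j).IsHomogeneous k) ∧
    (∀ j, ∑ i, MvPolynomial.pderiv i (MvPolynomial.pderiv i (P j)) = 0) ∧
    ∀ (p : USphere (Euc m)) (j : Fin (n + 1)),
      (v p : Euc n) j = MvPolynomial.eval (fun i => (p : Euc m) i) (P j)

/-- The map `w = (sin β · v₁, cos β · v₂)` from `S^m` to the unit sphere `S^(2n+1)` of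
`ℝ^(n+1) × ℝ^(n+1) = ℝ^(2n+2)` (with the Euclidean norm). -/
def joinMap (β : ℝ) (v₁ v₂ : USphere (Euc m) → USphere (Euc n)) :
    USphere (Euc m) → USphere (WithLp 2 (Euc n × Euc n)) :=
  fun p => ⟨WithLp.toLp 2 (Real.sin β • (v₁ p : Euc n), Real.cos β • (v₂ p : Euc n)), by
    rw [mem_sphere_zero_iff_norm, ← sq_eq_sq₀ (norm_nonneg _) zero_le_one,
      WithLp.prod_norm_sq_eq_of_L2]
    simp [norm_smul]⟩

end Maps

end SphereMaps

end

/-!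
A function `f` on the sphere may be differentiated through any extension `G` to the ambient space:
`df_p(x) = DG_p(x - ⟨p, x⟩ p)` (`dirDeriv_of_extension`), because the radial extension is `G`
composed with `x ↦ x / ‖x‖`. Applied to projected constant fields, this gives `∇_x y = 0` at `p`
for tangent `x, y`, hence the curvature `R(x, y)z = ⟨y, z⟩x - ⟨x, z⟩y` (`curv_eq`), and
`Ric = (m - 1) Id`, `Scal = m (m - 1)` for `S^m`. Consequently the conformal bitension field is
`τ₂ - C τ` with `C = (2/3)(m - 1)(m - 3)` (`conformalBitension_eq`), and the integrand of the energy
is `|τ|² + C |dφ|²` (`conformalBienergy_eq`).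

For a map `φ` into a sphere, differentiating `|φ|² = 1` twice gives `⟨Δφ, φ⟩ = -|dφ|²`, so that
`τ(φ) = Δφ + |dφ|² φ` (`tension_eq`). Thus `Δφ = μ φ` with `μ` constant means exactly that `φ` is
harmonic with `|dφ|² = -μ` constant.

Let `w = (sin β v₁, cos β v₂)` with `Δvᵢ = -λᵢ vᵢ`, and put `δ = λ₂ - λ₁`. Then
`τ(w) = δ sin β cos β (cos β v₁, -sin β v₂)`, which does not vanish. This section and its derivatives
are orthogonal to `w`, so its rough Laplacian is the tangential part of the componentwise one, and
`τ₂(w) = δ cos 2β τ(w)` (`bitension_joinMap`). The condition on `β` says precisely `δ cos 2β = C`.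
For instability the angle itself is varied: all the joins have constant energy density, the energy
is proportional to `δ² (1 - cos 4β) + 4 C (λ₁ + λ₂ + δ cos 2β)` (`conformalBienergy_joinMap`), and
its second derivative at the critical angle is a negative multiple of `δ² sin² 2β`.

For the restriction of a harmonic homogeneous polynomial of degree `k`, tracing the Hessian over the
tangent space and using Euler's identity twice gives the eigenvalue `-k (k + m - 1)`
(`laplaceBeltrami_eval`). Finally `β` exists if and only if `|C| < |λ₂ - λ₁|`; the absolute value of
`C` may be dropped, since `C < 0` only for `m = 2`, where `|C| = 2/3 < |λ₂ - λ₁|`.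
-/

noncomputable section

namespace SphereMaps

section Calculus

variable {E : Type*} [NormedAddCommGroup E] [InnerProductSpace ℝ E]
variable {F : Type*} [NormedAddCommGroup F] [InnerProductSpace ℝ F]
variable {V : Type*} [NormedAddCommGroup V] [NormedSpace ℝ V]
variable {V' : Type*} [NormedAddCommGroup V'] [NormedSpace ℝ V']
variable {V'' : Type*} [NormedAddCommGroup V''] [NormedSpace ℝ V'']

/-! ### Derivatives on the sphere through arbitrary extensions -/

omit [InnerProductSpace ℝ E] in
@[simp] lemma norm_coe_sphere (p : USphere E) : ‖(p : E)‖ = 1 := mem_sphere_zero_iff_norm.1 p.2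

omit [InnerProductSpace ℝ E] in
lemma coe_sphere_ne_zero (p : USphere E) : (p : E) ≠ 0 :=
  norm_ne_zero_iff.1 (by rw [norm_coe_sphere]; exact one_ne_zero)

@[simp] lemma inner_coe_self (p : USphere E) : inner ℝ (p : E) (p : E) = 1 := by
  rw [real_inner_self_eq_norm_sq, norm_coe_sphere]; norm_num

/-- The projection onto the tangent space at `p` as a continuous linear map. -/
def tangProjL (p : USphere E) : E →L[ℝ] E :=
  ContinuousLinearMap.id ℝ E - (innerSL ℝ (p : E)).smulRight (p : E)

@[simp] lemma tangProjL_apply (p : USphere E) (x : E) : tangProjL p x = tangProj p x := by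
  simp [tangProjL, tangProj]

@[simp] lemma tangProj_self (p : USphere E) : tangProj p (p : E) = 0 := by
  simp [tangProj]

@[simp] lemma tangProj_zero (p : USphere E) : tangProj p (0 : E) = 0 := by
  simp [tangProj]

lemma tangProj_smul (p : USphere E) (c : ℝ) (x : E) : tangProj p (c • x) = c • tangProj p x := by
  rw [← tangProjL_apply, map_smul, tangProjL_apply]

lemma tangProj_of_inner_eq_zero {p : USphere E} {x : E} (h : inner ℝ (p : E) x = 0) :
    tangProj p x = x := by
  simp [tangProj, h]

@[simp] lemma inner_tangProj (p : USphere E) (x : E) : inner ℝ (p : E) (tangProj p x) = 0 := by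
  simp [tangProj, inner_sub_right, inner_smul_right]

@[simp] lemma tangProj_tangProj (p : USphere E) (x : E) :
    tangProj p (tangProj p x) = tangProj p x :=
  tangProj_of_inner_eq_zero (inner_tangProj p x)

omit [NormedSpace ℝ V] in
@[simp] lemma radialExt_coe (f : USphere E → V) (p : USphere E) : radialExt f (p : E) = f p := by
  have h := coe_sphere_ne_zero p
  simp only [radialExt, h, dite_false]
  congr 1
  ext
  simp

omit [NormedSpace ℝ V] in
lemma radialExt_of_ne_zero (f : USphere E → V) {x : E} (hx : x ≠ 0) :
    radialExt f x = f ⟨‖x‖⁻¹ • x, by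
      simp [norm_smul, inv_mul_cancel₀ (norm_ne_zero_iff.mpr hx)]⟩ := by
  simp [radialExt, hx]

lemma hasFDerivAt_normalize (p : USphere E) :
    HasFDerivAt (fun x : E => ‖x‖⁻¹ • x) (tangProjL p) (p : E) := by
  have h1 : HasFDerivAt (fun x : E => ‖x‖ ^ 2) (2 • innerSL ℝ (p : E)) (p : E) :=
    (hasStrictFDerivAt_norm_sq (p : E)).hasFDerivAt
  have h2 : HasFDerivAt (fun x : E => ‖x‖) (innerSL ℝ (p : E)) (p : E) := by
    have := h1.sqrt (by rw [norm_coe_sphere]; norm_num)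
    simp only [Real.sqrt_sq (norm_nonneg _)] at this
    convert this using 1
    ext y
    simp
  have h3 : HasFDerivAt (fun x : E => ‖x‖⁻¹) (-innerSL ℝ (p : E)) (p : E) := by
    have := (hasDerivAt_inv (x := ‖(p : E)‖) (by simp)).comp_hasFDerivAt (p : E) h2
    rw [norm_coe_sphere, one_pow, inv_one, neg_one_smul] at this
    exact this
  have h4 := h3.smul (hasFDerivAt_id (p : E))
  have h5 : tangProjL p = ‖(p : E)‖⁻¹ • ContinuousLinearMap.id ℝ E
      + (-innerSL ℝ (p : E)).smulRight (p : E) := by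
    ext y
    simp [tangProj, sub_eq_add_neg]
  rw [h5]
  exact h4

/-- If `G` extends `f` to the ambient space, then the radial extension of `f` is `G` composed with
the normalization `x ↦ x / ‖x‖`, whose derivative at `p` is the tangential projection. -/
lemma hasFDerivAt_radialExt {f : USphere E → V} {G : E → V} {G' : E →L[ℝ] V} {p : USphere E}
    (hG : HasFDerivAt G G' (p : E)) (hf : ∀ q : USphere E, f q = G q) :
    HasFDerivAt (radialExt f) (G' ∘L tangProjL p) (p : E) := by
  have hG2 : HasFDerivAt G G' (‖(p : E)‖⁻¹ • (p : E)) := by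
    simpa using hG
  refine (HasFDerivAt.comp (f := fun x : E => ‖x‖⁻¹ • x) (p : E) hG2
    (hasFDerivAt_normalize p)).congr_of_eventuallyEq ?_
  filter_upwards [isOpen_ne.mem_nhds (coe_sphere_ne_zero p)] with x hx
  rw [radialExt_of_ne_zero f hx, hf]
  rfl

lemma dirDeriv_of_extension {f : USphere E → V} {G : E → V} {G' : E →L[ℝ] V} {p : USphere E}
    (hG : HasFDerivAt G G' (p : E)) (hf : ∀ q : USphere E, f q = G q) (x : E) :
    dirDeriv f p x = G' (tangProj p x) := by
  rw [dirDeriv, (hasFDerivAt_radialExt hG hf).fderiv]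
  simp

lemma dirDeriv_tangProj {f : USphere E → V} {p : USphere E}
    (hf : DifferentiableAt ℝ (radialExt f) (p : E)) (x : E) :
    dirDeriv f p (tangProj p x) = dirDeriv f p x :=
  (dirDeriv_of_extension hf.hasFDerivAt (fun q => (radialExt_coe f q).symm) x).symm

@[simp] lemma dirDeriv_zero (f : USphere E → V) (p : USphere E) : dirDeriv f p (0 : E) = 0 := by
  simp [dirDeriv]

lemma dirDeriv_smul (f : USphere E → V) (p : USphere E) (c : ℝ) (x : E) :
    dirDeriv f p (c • x) = c • dirDeriv f p x := by
  simp [dirDeriv]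

lemma dirDeriv_const (c : V) (p : USphere E) (x : E) :
    dirDeriv (fun _ : USphere E => c) p x = 0 := by
  rw [dirDeriv_of_extension (hasFDerivAt_const c (p : E)) (fun _ => rfl)]
  simp

lemma hasFDerivAt_radialExt_clm_add {f : USphere E → V} {g : USphere E → V'} {p : USphere E}
    (hf : DifferentiableAt ℝ (radialExt f) (p : E))
    (hg : DifferentiableAt ℝ (radialExt g) (p : E)) (A : V →L[ℝ] V'') (B : V' →L[ℝ] V'') :
    HasFDerivAt (fun x => A (radialExt f x) + B (radialExt g x))
      (A ∘L fderiv ℝ (radialExt f) p + B ∘L fderiv ℝ (radialExt g) p) (p : E) :=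
  (A.hasFDerivAt.comp (p : E) hf.hasFDerivAt).add (B.hasFDerivAt.comp (p : E) hg.hasFDerivAt)

lemma dirDeriv_clm_add {f : USphere E → V} {g : USphere E → V'} {p : USphere E}
    (hf : DifferentiableAt ℝ (radialExt f) (p : E))
    (hg : DifferentiableAt ℝ (radialExt g) (p : E)) (A : V →L[ℝ] V'') (B : V' →L[ℝ] V'') (x : E) :
    dirDeriv (fun q => A (f q) + B (g q)) p x = A (dirDeriv f p x) + B (dirDeriv g p x) := by
  rw [dirDeriv_of_extension (hasFDerivAt_radialExt_clm_add hf hg A B) (by simp),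
    ← dirDeriv_tangProj hf x, ← dirDeriv_tangProj hg x]
  rfl

lemma dirDeriv_inner {f g : USphere E → F} {p : USphere E}
    (hf : DifferentiableAt ℝ (radialExt f) (p : E))
    (hg : DifferentiableAt ℝ (radialExt g) (p : E)) (x : E) :
    dirDeriv (fun q => inner ℝ (f q) (g q)) p x =
      inner ℝ (f p) (dirDeriv g p x) + inner ℝ (dirDeriv f p x) (g p) := by
  rw [dirDeriv_of_extension (hf.hasFDerivAt.inner ℝ hg.hasFDerivAt) (by simp),
    ← dirDeriv_tangProj hf x, ← dirDeriv_tangProj hg x]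
  simp [dirDeriv]

/-! ### Regularity, and the Hessian -/

/-- A vector-valued function on the sphere is of class `C²` when its radial extension is so at
every point of the sphere. -/
def IsC2 (f : USphere E → V) : Prop := ∀ p : USphere E, ContDiffAt ℝ 2 (radialExt f) (p : E)

lemma IsC2.differentiableAt {f : USphere E → V} (hf : IsC2 f) (p : USphere E) :
    DifferentiableAt ℝ (radialExt f) (p : E) := (hf p).differentiableAt (by norm_num)

lemma isC2_of_extension {f : USphere E → V} {G : E → V}
    (hG : ∀ p : USphere E, ContDiffAt ℝ 2 G (p : E)) (hf : ∀ q : USphere E, f q = G q) :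
    IsC2 f := by
  intro p
  have hG2 : ContDiffAt ℝ 2 G (‖(p : E)‖⁻¹ • (p : E)) := by
    simpa using hG p
  have hn : ContDiffAt ℝ 2 (fun x : E => ‖x‖⁻¹ • x) (p : E) :=
    ((contDiffAt_norm ℝ (coe_sphere_ne_zero p)).inv (by simp)).smul contDiffAt_id
  refine (ContDiffAt.comp (f := fun x : E => ‖x‖⁻¹ • x) (p : E) hG2 hn).congr_of_eventuallyEq ?_
  filter_upwards [isOpen_ne.mem_nhds (coe_sphere_ne_zero p)] with x hx
  rw [radialExt_of_ne_zero f hx, hf]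
  rfl

lemma IsC2.clm_add {f : USphere E → V} {g : USphere E → V'} (hf : IsC2 f) (hg : IsC2 g)
    (A : V →L[ℝ] V'') (B : V' →L[ℝ] V'') : IsC2 (fun q => A (f q) + B (g q)) :=
  isC2_of_extension (G := fun x => A (radialExt f x) + B (radialExt g x))
    (fun p => (A.contDiff.contDiffAt.comp (p : E) (hf p)).add
      (B.contDiff.contDiffAt.comp (p : E) (hg p))) (by simp)

lemma hasFDerivAt_tangField (y : E) (p : USphere E) :
    HasFDerivAt (fun z : E => y - inner ℝ z y • z)
      (-(inner ℝ (p : E) y • ContinuousLinearMap.id ℝ E + (innerSL ℝ y).smulRight (p : E)))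
      (p : E) := by
  have h1 : HasFDerivAt (fun z : E => inner ℝ z y) (innerSL ℝ y) (p : E) := by
    simpa [real_inner_comm] using (innerSL ℝ y).hasFDerivAt (x := (p : E))
  simpa using (h1.smul (hasFDerivAt_id (p : E))).const_sub y

/-- For `f` of class `C²`, the derivative of `f` along a projected constant field is
differentiable. -/
lemma IsC2.differentiableAt_dirDeriv {f : USphere E → V} (hf : IsC2 f) (y : E) (p : USphere E) :
    DifferentiableAt ℝ (radialExt (fun q => dirDeriv f q (tangField y q))) (p : E) := by
  have h1 : DifferentiableAt ℝ (fderiv ℝ (radialExt f)) (p : E) :=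
    ((hf p).fderiv_right (m := 1) (by norm_num)).differentiableAt (by norm_num)
  have h2 : DifferentiableAt ℝ (fun z : E => y - inner ℝ z y • z) (p : E) :=
    (hasFDerivAt_tangField y p).differentiableAt
  exact (hasFDerivAt_radialExt (h1.clm_apply h2).hasFDerivAt (fun q => rfl)).differentiableAt

lemma dirDeriv_tangField (y : E) (p : USphere E) (x : E) :
    dirDeriv (tangField y) p x =
      -(inner ℝ (p : E) y • tangProj p x + inner ℝ y (tangProj p x) • (p : E)) := by
  rw [dirDeriv_of_extension (f := tangField y) (hasFDerivAt_tangField y p) (fun _ => rfl)]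
  simp

/-- The projected constant fields satisfy `∇_X Y = -⟨q, y⟩ X` for tangent `X`. -/
lemma nabla_tangField (X : USphere E → E) (y : E) (q : USphere E) :
    nabla X (tangField y) q = -(inner ℝ (q : E) y • tangProj q (X q)) := by
  simp only [nabla, nablaAlong, id, dirDeriv_tangField, ← tangProjL_apply, map_neg, map_add,
    map_smul]
  simp

lemma tangField_of_inner_eq_zero {p : USphere E} {x : E} (h : inner ℝ (p : E) x = 0) :
    tangField x p = x := tangProj_of_inner_eq_zero h

lemma nabla_tangField_of_inner_eq_zero {p : USphere E} (X : USphere E → E) {y : E}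
    (hy : inner ℝ (p : E) y = 0) : nabla X (tangField y) p = 0 := by
  rw [nabla_tangField, hy, zero_smul, neg_zero]

lemma hess_of_inner_eq_zero (f : USphere E → V) {p : USphere E} (x : E) {y : E}
    (hy : inner ℝ (p : E) y = 0) :
    hess f p x y = dirDeriv (fun q => dirDeriv f q (tangField y q)) p x := by
  rw [hess, nabla_tangField_of_inner_eq_zero _ hy, dirDeriv_zero, sub_zero]

lemma hess_clm_add {f : USphere E → V} {g : USphere E → V'} (hf : IsC2 f) (hg : IsC2 g)
    (A : V →L[ℝ] V'') (B : V' →L[ℝ] V'') (p : USphere E) (x y : E) :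
    hess (fun q => A (f q) + B (g q)) p x y = A (hess f p x y) + B (hess g p x y) := by
  simp only [hess, dirDeriv_clm_add (hf.differentiableAt _) (hg.differentiableAt _)]
  rw [dirDeriv_clm_add (hf.differentiableAt_dirDeriv y p) (hg.differentiableAt_dirDeriv y p)]
  simp only [map_sub]
  abel

lemma secondFund_of_inner_eq_zero (φ : USphere E → USphere F) {p : USphere E} {x y : E}
    (hx : inner ℝ (p : E) x = 0) (hy : inner ℝ (p : E) y = 0) :
    secondFund φ p x y = tangProj (φ p) (hess (fun q => (φ q : F)) p x y) := by
  rw [secondFund, nabla_tangField_of_inner_eq_zero _ hy, hess_of_inner_eq_zero _ _ hy,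
    nablaAlong, tangField_of_inner_eq_zero hx]
  simp [differential]

/-! ### Curvature of the sphere -/

lemma curv_eq {p : USphere E} {x y z : E} (hx : inner ℝ (p : E) x = 0)
    (hy : inner ℝ (p : E) y = 0) (hz : inner ℝ (p : E) z = 0) :
    curv p x y z = inner ℝ y z • x - inner ℝ x z • y := by
  have key : ∀ x y : E, inner ℝ (p : E) x = 0 → inner ℝ (p : E) y = 0 →
      nabla (tangField x) (nabla (tangField y) (tangField z)) p = -(inner ℝ x z • y) := by
    intro x y hx hy
    have hext : ∀ q : USphere E, nabla (tangField y) (tangField z) q =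
        (fun w : E => -(inner ℝ w z • (y - inner ℝ w y • w))) q := by
      intro q
      rw [nabla_tangField]
      rw [tangField, tangProj_tangProj, tangProj]
    have h1 : HasFDerivAt (fun w : E => inner ℝ w z) (innerSL ℝ z) (p : E) := by
      simpa [real_inner_comm] using (innerSL ℝ z).hasFDerivAt (x := (p : E))
    have hd := (h1.smul (hasFDerivAt_tangField y p)).neg
    rw [nabla, nablaAlong, dirDeriv_of_extension hd hext, tangField_of_inner_eq_zero hx,
      tangProj_of_inner_eq_zero hx]
    simp [hz, hy, ← tangProjL_apply, real_inner_comm]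
    simp [tangProj_of_inner_eq_zero hy]
  have hbr : lieBracket (tangField x) (tangField y) p = 0 := by
    simp only [lieBracket, dirDeriv_tangField, tangField_of_inner_eq_zero hx,
      tangField_of_inner_eq_zero hy, tangProj_of_inner_eq_zero hx, tangProj_of_inner_eq_zero hy,
      hx, hy, real_inner_comm x y]
    simp
  rw [curv, key x y hx hy, key y x hy hx, nabla_tangField, hbr]
  simp
  abel

variable [FiniteDimensional ℝ E]

/-! ### Traces over the tangent space -/

lemma inner_basis (p : USphere E) (i) :
    inner ℝ (p : E) (stdOrthonormalBasis ℝ (ℝ ∙ (p : E))ᗮ i : E) = 0 :=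
  Submodule.mem_orthogonal_singleton_iff_inner_right.1 (stdOrthonormalBasis ℝ (ℝ ∙ (p : E))ᗮ i).2

omit [NormedSpace ℝ V] in
lemma tr_congr {p : USphere E} {B C : E → E → V}
    (h : ∀ x : E, inner ℝ (p : E) x = 0 → B x x = C x x) : tr p B = tr p C :=
  Finset.sum_congr rfl fun i _ => h _ (inner_basis p i)

omit [NormedSpace ℝ V] in
lemma tr_add (p : USphere E) (B C : E → E → V) :
    tr p (fun x y => B x y + C x y) = tr p B + tr p C := Finset.sum_add_distrib

lemma clm_tr (A : V →L[ℝ] V') (p : USphere E) (B : E → E → V) :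
    A (tr p B) = tr p (fun x y => A (B x y)) := map_sum A _ _

lemma tr_smul (c : ℝ) (p : USphere E) (B : E → E → V) :
    tr p (fun x y => c • B x y) = c • tr p B := Finset.smul_sum.symm

lemma tr_smul_const (v : V) (p : USphere E) (B : E → E → ℝ) :
    tr p (fun x y => B x y • v) = tr p B • v := (Finset.sum_smul ..).symm

lemma tr_inner_smul (p : USphere E) (u : E) :
    tr p (fun z z' => inner ℝ u z • z') = tangProj p u := by
  set b := stdOrthonormalBasis ℝ (ℝ ∙ (p : E))ᗮ
  have hmem : tangProj p u ∈ (ℝ ∙ (p : E))ᗮ :=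
    Submodule.mem_orthogonal_singleton_iff_inner_right.2 (inner_tangProj p u)
  have h := congrArg Subtype.val (b.sum_repr' ⟨tangProj p u, hmem⟩)
  rw [AddSubmonoidClass.coe_finsetSum] at h
  refine Eq.trans ?_ h
  refine Finset.sum_congr rfl fun i _ => ?_
  have hi : inner ℝ u (b i : E) = inner ℝ (b i : E) (tangProj p u) := by
    rw [tangProj, inner_sub_right, inner_smul_right, real_inner_comm (p : E), inner_basis p i,
      real_inner_comm, mul_zero, sub_zero]
  exact congrArg (· • (b i : E)) hi

lemma tr_inner_mul_inner (p : USphere E) (u v : E) :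
    tr p (fun z z' => inner ℝ u z * inner ℝ v z') =
      inner ℝ u v - inner ℝ (p : E) u * inner ℝ (p : E) v := by
  have h := clm_tr (innerSL ℝ v) p (fun z z' => inner ℝ u z • z')
  rw [tr_inner_smul] at h
  simp only [map_smul, innerSL_apply_apply, smul_eq_mul] at h
  rw [← h, tangProj, inner_sub_right, inner_smul_right, real_inner_comm u v,
    real_inner_comm (p : E) v]

lemma tr_inner_self {m : ℕ} (hE : Module.finrank ℝ E = m + 1) (p : USphere E) :
    tr p (fun x y => inner ℝ x y) = (m : ℝ) := by
  have : Fact (Module.finrank ℝ E = m + 1) := ⟨hE⟩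
  have h : ∀ i, inner ℝ (stdOrthonormalBasis ℝ (ℝ ∙ (p : E))ᗮ i : E)
      (stdOrthonormalBasis ℝ (ℝ ∙ (p : E))ᗮ i : E) = (1 : ℝ) := by
    intro i
    rw [← Submodule.coe_inner, real_inner_self_eq_norm_sq,
      (stdOrthonormalBasis ℝ (ℝ ∙ (p : E))ᗮ).norm_eq_one]
    norm_num
  simp only [tr, h]
  simp [Submodule.finrank_orthogonal_span_singleton (n := m) (coe_sphere_ne_zero p)]

/-! ### Ricci and scalar curvature of the sphere -/

lemma ric_eq {m : ℕ} (hE : Module.finrank ℝ E = m + 1) {p : USphere E} {x y : E}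
    (hx : inner ℝ (p : E) x = 0) (hy : inner ℝ (p : E) y = 0) :
    ric p x y = ((m : ℝ) - 1) * inner ℝ x y := by
  have h1 : ric p x y = tr p (fun z z' => inner ℝ x y • inner ℝ z z'
      + (-1 : ℝ) • (inner ℝ y z * inner ℝ x z')) := by
    refine tr_congr fun z hz => ?_
    rw [curv_eq hz hx hy, inner_sub_left, inner_smul_left, inner_smul_left, real_inner_comm z y]
    simp
    ring
  rw [h1, tr_add, tr_smul, tr_smul, tr_inner_self hE, tr_inner_mul_inner, hx, hy,
    real_inner_comm]
  simp
  ring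

lemma ricEndo_eq {m : ℕ} (hE : Module.finrank ℝ E = m + 1) {p : USphere E} {x : E}
    (hx : inner ℝ (p : E) x = 0) : ricEndo p x = ((m : ℝ) - 1) • x := by
  have h1 : ricEndo p x = tr p (fun z z' => ((m : ℝ) - 1) • (inner ℝ x z • z')) := by
    refine tr_congr fun z hz => ?_
    rw [ric_eq hE hx hz, mul_smul]
  rw [h1, tr_smul, tr_inner_smul, tangProj_of_inner_eq_zero hx]

lemma scal_eq {m : ℕ} (hE : Module.finrank ℝ E = m + 1) (p : USphere E) :
    scal p = (m : ℝ) * ((m : ℝ) - 1) := by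
  have h1 : scal p = tr p (fun x y => ((m : ℝ) - 1) • inner ℝ x y) :=
    tr_congr fun z hz => by rw [ric_eq hE hz hz, smul_eq_mul]
  rw [h1, tr_smul, tr_inner_self hE, smul_eq_mul, mul_comm]

lemma gradScal_eq_zero {m : ℕ} (hE : Module.finrank ℝ E = m + 1) (p : USphere E) :
    gradScal p = 0 := by
  have h : (scal : USphere E → ℝ) = fun _ => (m : ℝ) * ((m : ℝ) - 1) := funext (scal_eq hE)
  simp [gradScal, h, dirDeriv_const, tr]

/-! ### The tension field of a map between spheres -/

lemma laplaceBeltrami_clm_add {f : USphere E → V} {g : USphere E → V'} (hf : IsC2 f)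
    (hg : IsC2 g) (A : V →L[ℝ] V'') (B : V' →L[ℝ] V'') (p : USphere E) :
    laplaceBeltrami (fun q => A (f q) + B (g q)) p =
      A (laplaceBeltrami f p) + B (laplaceBeltrami g p) := by
  rw [laplaceBeltrami, laplaceBeltrami, laplaceBeltrami, clm_tr, clm_tr, ← tr_add]
  exact tr_congr fun x _ => hess_clm_add hf hg A B p x x

omit [FiniteDimensional ℝ E] in
lemma inner_differential {φ : USphere E → USphere F} (hφ : IsC2 fun q => (φ q : F))
    (p : USphere E) (x : E) : inner ℝ (φ p : F) (differential φ p x) = 0 := by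
  have h := dirDeriv_inner (hφ.differentiableAt p) (hφ.differentiableAt p) x
  simp only [inner_coe_self, dirDeriv_const] at h
  rw [real_inner_comm (φ p : F)] at h
  rw [differential]
  linarith

omit [FiniteDimensional ℝ E] in
/-- Differentiating `|φ|² = 1` twice. -/
lemma inner_hess_self {φ : USphere E → USphere F} (hφ : IsC2 fun q => (φ q : F))
    {p : USphere E} {x : E} (hx : inner ℝ (p : E) x = 0) :
    inner ℝ (φ p : F) (hess (fun q => (φ q : F)) p x x) =
      -inner ℝ (differential φ p x) (differential φ p x) := by
  have h := dirDeriv_inner (hφ.differentiableAt p) (hφ.differentiableAt_dirDeriv x p) x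
  have h0 : (fun q => inner ℝ (φ q : F) (dirDeriv (fun q => (φ q : F)) q (tangField x q))) =
      fun _ => (0 : ℝ) := funext fun q => inner_differential hφ q _
  rw [h0, dirDeriv_const, tangField_of_inner_eq_zero hx] at h
  rw [hess_of_inner_eq_zero _ _ hx]
  simp only [differential]
  linarith

lemma inner_laplaceBeltrami_self {φ : USphere E → USphere F} (hφ : IsC2 fun q => (φ q : F))
    (p : USphere E) :
    inner ℝ (φ p : F) (laplaceBeltrami (fun q => (φ q : F)) p) = -gradSq φ p := by
  have h := clm_tr (innerSL ℝ (φ p : F)) p (hess (fun q => (φ q : F)) p)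
  simp only [innerSL_apply_apply] at h
  have h1 : -gradSq φ p = (-1 : ℝ) • gradSq φ p := by simp
  rw [laplaceBeltrami, h, h1, gradSq, ← tr_smul]
  refine tr_congr fun x hx => ?_
  rw [inner_hess_self hφ hx]
  simp

/-- The classical formula `τ(φ) = Δφ + |dφ|² φ` for maps into a round sphere. -/
lemma tension_eq {φ : USphere E → USphere F} (hφ : IsC2 fun q => (φ q : F)) (p : USphere E) :
    tension φ p = laplaceBeltrami (fun q => (φ q : F)) p + gradSq φ p • (φ p : F) := by
  have h : tension φ p = tangProj (φ p) (laplaceBeltrami (fun q => (φ q : F)) p) := by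
    rw [← tangProjL_apply, laplaceBeltrami, clm_tr]
    refine tr_congr fun x hx => ?_
    rw [secondFund_of_inner_eq_zero φ hx hx, tangProjL_apply]
  rw [h, tangProj, inner_laplaceBeltrami_self hφ, neg_smul, sub_neg_eq_add]

/-- If `W` is a section along `φ` all of whose derivatives are tangent to the sphere, then its
rough Laplacian is the tangential part of its componentwise Laplacian. -/
lemma roughLaplacian_eq {φ : USphere E → USphere F} {W : USphere E → F}
    (hW : ∀ (p : USphere E) (x : E), inner ℝ (φ p : F) (dirDeriv W p x) = 0) (p : USphere E) :
    roughLaplacian φ W p = tangProj (φ p) (laplaceBeltrami W p) := by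
  rw [← tangProjL_apply, laplaceBeltrami, clm_tr]
  refine tr_congr fun x hx => ?_
  have h1 : nablaAlong φ (tangField x) W = fun q => dirDeriv W q (tangField x q) :=
    funext fun q => tangProj_of_inner_eq_zero (hW q _)
  rw [h1, hess_of_inner_eq_zero _ _ hx, tangProjL_apply, nablaAlong, nablaAlong,
    nabla_tangField_of_inner_eq_zero _ hx, dirDeriv_zero, tangProj_zero, sub_zero,
    tangField_of_inner_eq_zero hx]

/-- On a round sphere of dimension `m`, the curvature terms of the conformal bitension field add
up to the multiple `-(2/3)(m-1)(m-3)` of the tension field. -/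
lemma conformalBitension_eq {m : ℕ} (hE : Module.finrank ℝ E = m + 1) (φ : USphere E → USphere F)
    (p : USphere E) :
    conformalBitension φ p =
      bitension φ p - (2 / 3 * ((m : ℝ) - 1) * ((m : ℝ) - 3)) • tension φ p := by
  have h : tr p (fun x y => secondFund φ p (ricEndo p x) y) = ((m : ℝ) - 1) • tension φ p := by
    rw [tension, ← tr_smul]
    refine tr_congr fun x hx => ?_
    have hx' : inner ℝ (p : E) (((m : ℝ) - 1) • x) = 0 := by rw [inner_smul_right, hx, mul_zero]
    rw [ricEndo_eq hE hx, secondFund_of_inner_eq_zero φ hx hx, secondFund_of_inner_eq_zero φ hx' hx,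
      hess_of_inner_eq_zero _ _ hx, hess_of_inner_eq_zero _ _ hx, dirDeriv_smul, tangProj_smul]
  rw [conformalBitension, h, gradScal_eq_zero hE, scal_eq hE, differential, dirDeriv_zero]
  module

/-- On a round sphere of dimension `m`, the integrand of the conformal bienergy is
`|τ(φ)|² + (2/3)(m-1)(m-3)|dφ|²`. -/
lemma conformalBienergy_eq [MeasureSpace E] [BorelSpace E] {m : ℕ}
    (hE : Module.finrank ℝ E = m + 1) (φ : USphere E → USphere F) :
    conformalBienergy φ = (1 / 2) * ∫ p, (‖tension φ p‖ ^ 2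
      + 2 / 3 * ((m : ℝ) - 1) * ((m : ℝ) - 3) * gradSq φ p) ∂((volume : Measure E).toSphere) := by
  rw [conformalBienergy]
  congr 2
  funext p
  have h : tr p (fun x y => inner ℝ (differential φ p (ricEndo p x)) (differential φ p y)) =
      ((m : ℝ) - 1) * gradSq φ p := by
    rw [gradSq, ← smul_eq_mul, ← tr_smul]
    refine tr_congr fun x hx => ?_
    rw [ricEndo_eq hE hx, differential, dirDeriv_smul, inner_smul_left]
    rfl
  rw [h, scal_eq hE]
  ring

end Calculus

section Maps

variable {m n : ℕ} {F : Type*} [NormedAddCommGroup F] [InnerProductSpace ℝ F]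

/-! ### Smooth maps, harmonic maps and eigenmaps -/

lemma finrank_euc (m : ℕ) : Module.finrank ℝ (Euc m) = m + 1 := by simp

lemma IsSmooth.isC2 {φ : USphere (Euc m) → USphere F} (h : IsSmooth φ) :
    IsC2 fun q => (φ q : F) := by
  intro p
  have : Fact (Module.finrank ℝ (Euc m) = m + 1) := ⟨finrank_euc m⟩
  let U : TopologicalSpace.Opens (Euc m) := ⟨{x | x ≠ 0}, isOpen_ne⟩
  have hU : ∀ x : U, (x : Euc m) ≠ 0 := fun x => x.2
  have hval : ContMDiff 𝓘(ℝ, Euc m) 𝓘(ℝ, Euc m) ∞ (fun x : U => (x : Euc m)) :=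
    contMDiff_subtype_val
  have hn : ContMDiff 𝓘(ℝ, Euc m) 𝓘(ℝ, Euc m) ∞
      (fun x : U => ‖(x : Euc m)‖⁻¹ • (x : Euc m)) := by
    intro x
    have h1 : ContDiffAt ℝ ∞ (fun x : Euc m => ‖x‖⁻¹ • x) (x : Euc m) :=
      ((contDiffAt_norm ℝ (hU x)).inv (norm_ne_zero_iff.2 (hU x))).smul contDiffAt_id
    exact h1.contMDiffAt.comp x (hval x)
  have hs := hn.codRestrict_sphere (n := m) (fun x => by
    simp [norm_smul, inv_mul_cancel₀ (norm_ne_zero_iff.mpr (hU x))])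
  have hc := h.comp hs
  have h1 : ContMDiff 𝓘(ℝ, Euc m) 𝓘(ℝ, F) ∞
      (fun x : U => radialExt (fun q => (φ q : F)) (x : Euc m)) := by
    refine hc.congr fun x => ?_
    rw [radialExt_of_ne_zero _ (hU x)]
    rfl
  have h2 := h1 ⟨p, coe_sphere_ne_zero p⟩
  rw [contMDiffAt_subtype_iff, contMDiffAt_iff_contDiffAt] at h2
  exact h2.of_le (WithTop.coe_le_coe.2 le_top)

/-- A map into the sphere with `Δφ = μ φ` has constant `|dφ|² = -μ`. -/
lemma gradSq_of_laplaceBeltrami {φ : USphere (Euc m) → USphere F} (hφ : IsC2 fun q => (φ q : F))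
    {μ : ℝ} (h : ∀ p, laplaceBeltrami (fun q => (φ q : F)) p = μ • (φ p : F))
    (p : USphere (Euc m)) : gradSq φ p = -μ := by
  have h1 := inner_laplaceBeltrami_self hφ p
  rw [h, inner_smul_right, inner_coe_self] at h1
  linarith

lemma laplaceBeltrami_apply {f : USphere (Euc m) → Euc n} (hf : IsC2 f) (j : Fin (n + 1))
    (p : USphere (Euc m)) :
    laplaceBeltrami (fun q => f q j) p = laplaceBeltrami f p j := by
  simpa using laplaceBeltrami_clm_add hf hf (EuclideanSpace.proj (𝕜 := ℝ) j)
    (0 : Euc n →L[ℝ] ℝ) p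

lemma isEigenmap_iff {v : USphere (Euc m) → USphere (Euc n)} :
    IsEigenmap v ↔ IsSmooth v ∧
      ∃ μ : ℝ, ∀ p, laplaceBeltrami (fun q => (v q : Euc n)) p = μ • (v p : Euc n) := by
  refine and_congr_right fun hs => exists_congr fun μ => ?_
  simp only [laplaceBeltrami_apply hs.isC2]
  constructor
  · intro h p
    ext j
    simpa using h j p
  · intro h j p
    simp [h p]

lemma isEigenmap_iff_isHarmonic (v : USphere (Euc m) → USphere (Euc n)) :
    IsEigenmap v ↔ IsHarmonic v ∧ ∃ lam : ℝ, ∀ p, gradSq v p = lam := by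
  rw [isEigenmap_iff]
  constructor
  · rintro ⟨hs, μ, hμ⟩
    refine ⟨⟨hs, fun p => ?_⟩, -μ, gradSq_of_laplaceBeltrami hs.isC2 hμ⟩
    rw [tension_eq hs.isC2, hμ, gradSq_of_laplaceBeltrami hs.isC2 hμ]
    module
  · rintro ⟨⟨hs, ht⟩, lam, hlam⟩
    refine ⟨hs, -lam, fun p => ?_⟩
    have h := ht p
    rw [tension_eq hs.isC2, hlam] at h
    rw [eq_neg_of_add_eq_zero_left h, neg_smul]

lemma IsEigenmap.laplaceBeltrami_eq {v : USphere (Euc m) → USphere (Euc n)} (h : IsEigenmap v)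
    {lam : ℝ} (hlam : ∀ p, gradSq v p = lam) (p : USphere (Euc m)) :
    laplaceBeltrami (fun q => (v q : Euc n)) p = (-lam) • (v p : Euc n) := by
  obtain ⟨hs, μ, hμ⟩ := isEigenmap_iff.1 h
  rw [hμ, ← hlam p, gradSq_of_laplaceBeltrami hs.isC2 hμ, neg_neg]

/-! ### The join of two eigenmaps -/

/-- The vector-valued map `(a f₁, b f₂)`. -/
def pair (a b : ℝ) (f₁ f₂ : USphere (Euc m) → Euc n) (p : USphere (Euc m)) :
    WithLp 2 (Euc n × Euc n) :=
  WithLp.toLp 2 (a • f₁ p, b • f₂ p)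

/-- The inclusion of the first factor of the Euclidean product. -/
def inlL (n : ℕ) : Euc n →L[ℝ] WithLp 2 (Euc n × Euc n) :=
  ((WithLp.prodContinuousLinearEquiv 2 ℝ (Euc n) (Euc n)).symm :
    (Euc n × Euc n) →L[ℝ] WithLp 2 (Euc n × Euc n)) ∘L ContinuousLinearMap.inl ℝ (Euc n) (Euc n)

/-- The inclusion of the second factor of the Euclidean product. -/
def inrL (n : ℕ) : Euc n →L[ℝ] WithLp 2 (Euc n × Euc n) :=
  ((WithLp.prodContinuousLinearEquiv 2 ℝ (Euc n) (Euc n)).symm :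
    (Euc n × Euc n) →L[ℝ] WithLp 2 (Euc n × Euc n)) ∘L ContinuousLinearMap.inr ℝ (Euc n) (Euc n)

lemma toLp_eq_inlL_add_inrL (x y : Euc n) :
    WithLp.toLp 2 (x, y) = inlL n x + inrL n y := by
  simp [inlL, inrL, ← WithLp.toLp_add]

lemma pair_eq (a b : ℝ) (f₁ f₂ : USphere (Euc m) → Euc n) :
    pair a b f₁ f₂ = fun p => (a • inlL n) (f₁ p) + (b • inrL n) (f₂ p) := by
  funext p
  simp [pair, toLp_eq_inlL_add_inrL]

lemma smul_pair (c a b : ℝ) (f₁ f₂ : USphere (Euc m) → Euc n) (p : USphere (Euc m)) :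
    c • pair a b f₁ f₂ p = pair (c * a) (c * b) f₁ f₂ p := by
  simp [pair, ← WithLp.toLp_smul, mul_smul]

lemma add_pair (a b c d : ℝ) (f₁ f₂ : USphere (Euc m) → Euc n) (p : USphere (Euc m)) :
    pair a b f₁ f₂ p + pair c d f₁ f₂ p = pair (a + c) (b + d) f₁ f₂ p := by
  simp [pair, ← WithLp.toLp_add, add_smul]

lemma isC2_pair {f₁ f₂ : USphere (Euc m) → Euc n} (h₁ : IsC2 f₁) (h₂ : IsC2 f₂) (a b : ℝ) :
    IsC2 (pair a b f₁ f₂) := by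
  rw [pair_eq]
  exact h₁.clm_add h₂ _ _

lemma dirDeriv_pair {f₁ f₂ : USphere (Euc m) → Euc n} (h₁ : IsC2 f₁) (h₂ : IsC2 f₂) (a b : ℝ)
    (p : USphere (Euc m)) (x : Euc m) :
    dirDeriv (pair a b f₁ f₂) p x =
      WithLp.toLp 2 (a • dirDeriv f₁ p x, b • dirDeriv f₂ p x) := by
  rw [pair_eq, dirDeriv_clm_add (h₁.differentiableAt p) (h₂.differentiableAt p)]
  simp [toLp_eq_inlL_add_inrL]

lemma laplaceBeltrami_pair {f₁ f₂ : USphere (Euc m) → Euc n} (h₁ : IsC2 f₁) (h₂ : IsC2 f₂)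
    {μ₁ μ₂ : ℝ} {p : USphere (Euc m)} (e₁ : laplaceBeltrami f₁ p = μ₁ • f₁ p)
    (e₂ : laplaceBeltrami f₂ p = μ₂ • f₂ p) (a b : ℝ) :
    laplaceBeltrami (pair a b f₁ f₂) p = pair (μ₁ * a) (μ₂ * b) f₁ f₂ p := by
  rw [pair_eq, laplaceBeltrami_clm_add h₁ h₂, e₁, e₂, pair_eq]
  simp only [_root_.smul_apply, map_smul, smul_smul]

lemma inner_pair (v₁ v₂ : USphere (Euc m) → USphere (Euc n)) (a b c d : ℝ)
    (p : USphere (Euc m)) :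
    inner ℝ (pair a b (fun q => (v₁ q : Euc n)) (fun q => (v₂ q : Euc n)) p)
      (pair c d (fun q => (v₁ q : Euc n)) (fun q => (v₂ q : Euc n)) p) = a * c + b * d := by
  simp [pair, WithLp.prod_inner_apply, inner_smul_left, inner_smul_right]
  ring

lemma inner_pair_dirDeriv {v₁ v₂ : USphere (Euc m) → USphere (Euc n)}
    (h₁ : IsC2 fun q => (v₁ q : Euc n)) (h₂ : IsC2 fun q => (v₂ q : Euc n)) (a b c d : ℝ)
    (p : USphere (Euc m)) (x : Euc m) :
    inner ℝ (pair a b (fun q => (v₁ q : Euc n)) (fun q => (v₂ q : Euc n)) p)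
      (dirDeriv (pair c d (fun q => (v₁ q : Euc n)) (fun q => (v₂ q : Euc n))) p x) = 0 := by
  have e₁ := inner_differential h₁ p x
  have e₂ := inner_differential h₂ p x
  rw [differential] at e₁ e₂
  rw [dirDeriv_pair h₁ h₂]
  simp [pair, WithLp.prod_inner_apply, inner_smul_left, inner_smul_right, e₁, e₂]

lemma coe_joinMap_apply (β : ℝ) (v₁ v₂ : USphere (Euc m) → USphere (Euc n))
    (q : USphere (Euc m)) : (joinMap β v₁ v₂ q : WithLp 2 (Euc n × Euc n)) =
      pair (Real.sin β) (Real.cos β) (fun q => (v₁ q : Euc n)) (fun q => (v₂ q : Euc n)) q := rfl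

lemma coe_joinMap (β : ℝ) (v₁ v₂ : USphere (Euc m) → USphere (Euc n)) :
    (fun q => (joinMap β v₁ v₂ q : WithLp 2 (Euc n × Euc n))) =
      pair (Real.sin β) (Real.cos β) (fun q => (v₁ q : Euc n)) (fun q => (v₂ q : Euc n)) := rfl

/-- Joining with a moving angle is a smooth variation. -/
lemma contMDiff_joinMap {v₁ v₂ : USphere (Euc m) → USphere (Euc n)} (h₁ : IsSmooth v₁)
    (h₂ : IsSmooth v₂) (β : ℝ) :
    ContMDiff (𝓘(ℝ, ℝ).prod (𝓡 m)) 𝓘(ℝ, WithLp 2 (Euc n × Euc n)) ∞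
      (fun z : ℝ × USphere (Euc m) =>
        (joinMap (β + z.1) v₁ v₂ z.2 : WithLp 2 (Euc n × Euc n))) := by
  have hfun : (fun z : ℝ × USphere (Euc m) =>
      (joinMap (β + z.1) v₁ v₂ z.2 : WithLp 2 (Euc n × Euc n))) = fun z =>
      inlL n (Real.sin (β + z.1) • (v₁ z.2 : Euc n))
        + inrL n (Real.cos (β + z.1) • (v₂ z.2 : Euc n)) :=
    funext fun z => toLp_eq_inlL_add_inrL _ _
  have hs : ContDiff ℝ ∞ fun t : ℝ => Real.sin (β + t) := by fun_prop
  have hc : ContDiff ℝ ∞ fun t : ℝ => Real.cos (β + t) := by fun_prop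
  rw [hfun]
  exact ((inlL n).contMDiff.comp
      ((hs.contMDiff.comp contMDiff_fst).smul (h₁.comp contMDiff_snd))).add
    ((inrL n).contMDiff.comp
      ((hc.contMDiff.comp contMDiff_fst).smul (h₂.comp contMDiff_snd)))

lemma isSmooth_joinMap {v₁ v₂ : USphere (Euc m) → USphere (Euc n)} (h₁ : IsSmooth v₁)
    (h₂ : IsSmooth v₂) (β : ℝ) : IsSmooth (joinMap β v₁ v₂) := by
  have h := (contMDiff_joinMap h₁ h₂ β).comp
    ((contMDiff_const (c := (0 : ℝ)) (I := 𝓡 m) (I' := 𝓘(ℝ, ℝ))).prodMk contMDiff_id)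
  simpa [IsSmooth, Function.comp_def] using h

section Join

variable {v₁ v₂ : USphere (Euc m) → USphere (Euc n)} {lam₁ lam₂ : ℝ}

lemma gradSq_joinMap (h₁ : IsC2 fun q => (v₁ q : Euc n)) (h₂ : IsC2 fun q => (v₂ q : Euc n))
    (e₁ : ∀ p, laplaceBeltrami (fun q => (v₁ q : Euc n)) p = (-lam₁) • (v₁ p : Euc n))
    (e₂ : ∀ p, laplaceBeltrami (fun q => (v₂ q : Euc n)) p = (-lam₂) • (v₂ p : Euc n))
    (β : ℝ) (p : USphere (Euc m)) :
    gradSq (joinMap β v₁ v₂) p = Real.sin β ^ 2 * lam₁ + Real.cos β ^ 2 * lam₂ := by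
  have h := inner_laplaceBeltrami_self (φ := joinMap β v₁ v₂)
    (isC2_pair h₁ h₂ (Real.sin β) (Real.cos β)) p
  rw [coe_joinMap, laplaceBeltrami_pair h₁ h₂ (e₁ p) (e₂ p)] at h
  have h' := inner_pair v₁ v₂ (Real.sin β) (Real.cos β) (-lam₁ * Real.sin β)
    (-lam₂ * Real.cos β) p
  linarith [h.symm.trans h']

/-- The tension field of the join is a constant multiple of the unit section
`(cos β v₁, -sin β v₂)`, which is the velocity of the join when the angle moves. -/
lemma tension_joinMap (h₁ : IsC2 fun q => (v₁ q : Euc n)) (h₂ : IsC2 fun q => (v₂ q : Euc n))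
    (e₁ : ∀ p, laplaceBeltrami (fun q => (v₁ q : Euc n)) p = (-lam₁) • (v₁ p : Euc n))
    (e₂ : ∀ p, laplaceBeltrami (fun q => (v₂ q : Euc n)) p = (-lam₂) • (v₂ p : Euc n))
    (β : ℝ) :
    tension (joinMap β v₁ v₂) =
      pair ((lam₂ - lam₁) * Real.sin β * Real.cos β * Real.cos β)
        (-((lam₂ - lam₁) * Real.sin β * Real.cos β * Real.sin β))
        (fun q => (v₁ q : Euc n)) (fun q => (v₂ q : Euc n)) := by
  funext p
  rw [tension_eq (φ := joinMap β v₁ v₂) (isC2_pair h₁ h₂ (Real.sin β) (Real.cos β)),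
    gradSq_joinMap h₁ h₂ e₁ e₂, coe_joinMap, coe_joinMap_apply]
  rw [laplaceBeltrami_pair h₁ h₂ (e₁ p) (e₂ p), smul_pair, add_pair]
  congr 1
  · linear_combination lam₁ * Real.sin β * Real.sin_sq_add_cos_sq β
  · linear_combination lam₂ * Real.cos β * Real.sin_sq_add_cos_sq β

/-- The join satisfies `τ₂ = (λ₂ - λ₁) cos 2β τ`. -/
lemma bitension_joinMap (h₁ : IsC2 fun q => (v₁ q : Euc n)) (h₂ : IsC2 fun q => (v₂ q : Euc n))
    (e₁ : ∀ p, laplaceBeltrami (fun q => (v₁ q : Euc n)) p = (-lam₁) • (v₁ p : Euc n))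
    (e₂ : ∀ p, laplaceBeltrami (fun q => (v₂ q : Euc n)) p = (-lam₂) • (v₂ p : Euc n))
    (β : ℝ) (p : USphere (Euc m)) :
    bitension (joinMap β v₁ v₂) p =
      ((lam₂ - lam₁) * Real.cos (2 * β)) • tension (joinMap β v₁ v₂) p := by
  set T := (lam₂ - lam₁) * Real.sin β * Real.cos β with hT
  have ht := tension_joinMap h₁ h₂ e₁ e₂ β
  have hC := isC2_pair h₁ h₂ (Real.sin β) (Real.cos β)
  have hrough : roughLaplacian (joinMap β v₁ v₂) (tension (joinMap β v₁ v₂)) p =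
      (-(lam₁ * Real.cos β ^ 2 + lam₂ * Real.sin β ^ 2)) • tension (joinMap β v₁ v₂) p := by
    rw [ht, roughLaplacian_eq (φ := joinMap β v₁ v₂)
      (fun p x => inner_pair_dirDeriv h₁ h₂ _ _ _ _ p x),
      laplaceBeltrami_pair h₁ h₂ (e₁ p) (e₂ p), smul_pair, tangProj, coe_joinMap_apply,
      inner_pair, sub_eq_add_neg, ← neg_smul, smul_pair, add_pair]
    congr 1
    · linear_combination lam₁ * T * Real.cos β * Real.sin_sq_add_cos_sq β
    · linear_combination -(lam₂ * T * Real.sin β) * Real.sin_sq_add_cos_sq β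
  have hcurv : tr p (fun x y => curv (joinMap β v₁ v₂ p) (tension (joinMap β v₁ v₂) p)
      (differential (joinMap β v₁ v₂) p x) (differential (joinMap β v₁ v₂) p y)) =
      gradSq (joinMap β v₁ v₂) p • tension (joinMap β v₁ v₂) p := by
    rw [gradSq, ← tr_smul_const]
    refine tr_congr fun x _ => ?_
    have hd := inner_differential (φ := joinMap β v₁ v₂) hC p x
    have hτ : inner ℝ (joinMap β v₁ v₂ p : WithLp 2 (Euc n × Euc n))
        (tension (joinMap β v₁ v₂) p) = 0 := by
      rw [ht]
      refine (inner_pair v₁ v₂ (Real.sin β) (Real.cos β) _ _ p).trans ?_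
      ring
    have hτd : inner ℝ (tension (joinMap β v₁ v₂) p)
        (differential (joinMap β v₁ v₂) p x) = 0 := by
      rw [ht]
      exact inner_pair_dirDeriv h₁ h₂ _ _ _ _ p x
    rw [curv_eq hτ hd hd, hτd, zero_smul, sub_zero]
  rw [bitension, hrough, hcurv, gradSq_joinMap h₁ h₂ e₁ e₂, ← add_smul]
  congr 1
  rw [Real.cos_two_mul']
  ring

lemma norm_tension_joinMap_sq (h₁ : IsC2 fun q => (v₁ q : Euc n))
    (h₂ : IsC2 fun q => (v₂ q : Euc n))
    (e₁ : ∀ p, laplaceBeltrami (fun q => (v₁ q : Euc n)) p = (-lam₁) • (v₁ p : Euc n))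
    (e₂ : ∀ p, laplaceBeltrami (fun q => (v₂ q : Euc n)) p = (-lam₂) • (v₂ p : Euc n))
    (β : ℝ) (p : USphere (Euc m)) :
    ‖tension (joinMap β v₁ v₂) p‖ ^ 2 = ((lam₂ - lam₁) * Real.sin β * Real.cos β) ^ 2 := by
  rw [← real_inner_self_eq_norm_sq, tension_joinMap h₁ h₂ e₁ e₂, inner_pair]
  linear_combination ((lam₂ - lam₁) * Real.sin β * Real.cos β) ^ 2 * Real.sin_sq_add_cos_sq β

lemma isConformalBiharmonic_joinMap (h₁ : IsSmooth v₁) (h₂ : IsSmooth v₂)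
    (e₁ : ∀ p, laplaceBeltrami (fun q => (v₁ q : Euc n)) p = (-lam₁) • (v₁ p : Euc n))
    (e₂ : ∀ p, laplaceBeltrami (fun q => (v₂ q : Euc n)) p = (-lam₂) • (v₂ p : Euc n))
    {β : ℝ} (hβ : (lam₂ - lam₁) * Real.cos (2 * β) = 2 / 3 * ((m : ℝ) - 1) * ((m : ℝ) - 3)) :
    IsConformalBiharmonic (joinMap β v₁ v₂) := by
  refine ⟨isSmooth_joinMap h₁ h₂ β, fun p => ?_⟩
  rw [conformalBitension_eq (finrank_euc m), bitension_joinMap h₁.isC2 h₂.isC2 e₁ e₂, hβ, sub_self]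

lemma not_isHarmonic_joinMap (h₁ : IsSmooth v₁) (h₂ : IsSmooth v₂)
    (e₁ : ∀ p, laplaceBeltrami (fun q => (v₁ q : Euc n)) p = (-lam₁) • (v₁ p : Euc n))
    (e₂ : ∀ p, laplaceBeltrami (fun q => (v₂ q : Euc n)) p = (-lam₂) • (v₂ p : Euc n))
    (hne : lam₁ ≠ lam₂) {β : ℝ} (hs : 0 < Real.sin β) (hc : 0 < Real.cos β) :
    ¬ IsHarmonic (joinMap β v₁ v₂) := by
  rintro ⟨-, h⟩
  obtain ⟨p, hp⟩ : (Metric.sphere (0 : Euc m) 1).Nonempty :=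
    NormedSpace.sphere_nonempty.2 zero_le_one
  have h1 := norm_tension_joinMap_sq h₁.isC2 h₂.isC2 e₁ e₂ β ⟨p, hp⟩
  rw [h, norm_zero] at h1
  have h2 : (lam₂ - lam₁) * Real.sin β * Real.cos β ≠ 0 :=
    mul_ne_zero (mul_ne_zero (sub_ne_zero.2 hne.symm) hs.ne') hc.ne'
  exact h2 (pow_eq_zero_iff two_ne_zero |>.1 (by linarith))

/-- Along the family of joins the energy density is constant on the sphere, so that the energy is
an explicit trigonometric polynomial in the angle. -/
lemma conformalBienergy_joinMap (h₁ : IsC2 fun q => (v₁ q : Euc n))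
    (h₂ : IsC2 fun q => (v₂ q : Euc n))
    (e₁ : ∀ p, laplaceBeltrami (fun q => (v₁ q : Euc n)) p = (-lam₁) • (v₁ p : Euc n))
    (e₂ : ∀ p, laplaceBeltrami (fun q => (v₂ q : Euc n)) p = (-lam₂) • (v₂ p : Euc n))
    (β : ℝ) :
    conformalBienergy (joinMap β v₁ v₂) =
      (volume : Measure (Euc m)).toSphere.real Set.univ / 16 *
        ((lam₂ - lam₁) ^ 2 * (1 - Real.cos (4 * β))
          + 4 * (2 / 3 * ((m : ℝ) - 1) * ((m : ℝ) - 3)) *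
            (lam₁ + lam₂ + (lam₂ - lam₁) * Real.cos (2 * β))) := by
  rw [conformalBienergy_eq (finrank_euc m)]
  simp only [norm_tension_joinMap_sq h₁ h₂ e₁ e₂, gradSq_joinMap h₁ h₂ e₁ e₂]
  rw [integral_const, smul_eq_mul]
  have h4 : Real.cos (4 * β) = 2 * Real.cos (2 * β) ^ 2 - 1 := by
    rw [← Real.cos_two_mul]; congr 1; ring
  rw [h4, Real.cos_two_mul, mul_pow, mul_pow, Real.sin_sq]
  ring

/-- Moving the angle decreases the energy to second order. -/
lemma isUnstable_joinMap (h₁ : IsSmooth v₁) (h₂ : IsSmooth v₂)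
    (e₁ : ∀ p, laplaceBeltrami (fun q => (v₁ q : Euc n)) p = (-lam₁) • (v₁ p : Euc n))
    (e₂ : ∀ p, laplaceBeltrami (fun q => (v₂ q : Euc n)) p = (-lam₂) • (v₂ p : Euc n))
    (hne : lam₁ ≠ lam₂) {β : ℝ} (hs : 0 < Real.sin β) (hc : 0 < Real.cos β)
    (hβ : (lam₂ - lam₁) * Real.cos (2 * β) = 2 / 3 * ((m : ℝ) - 1) * ((m : ℝ) - 3)) :
    IsUnstable (joinMap β v₁ v₂) := by
  refine ⟨fun t => joinMap (β + t) v₁ v₂, contMDiff_joinMap h₁ h₂ β, by simp, ?_⟩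
  simp only [conformalBienergy_joinMap h₁.isC2 h₂.isC2 e₁ e₂]
  rw [← hβ]
  set δ := lam₂ - lam₁ with hδ
  set K := (volume : Measure (Euc m)).toSphere.real Set.univ with hK
  have hKpos : 0 < K := by
    have hnt : Nontrivial (Euc m) := inferInstance
    have h0 : (volume : Measure (Euc m)).toSphere ≠ 0 := Measure.toSphere_ne_zero _
    have : NeZero (volume : Measure (Euc m)).toSphere := ⟨h0⟩
    exact measureReal_univ_pos
  have harg : ∀ a t : ℝ, HasDerivAt (fun t : ℝ => a * (β + t)) a t := fun a t => by
    simpa using ((hasDerivAt_id t).const_add β).const_mul a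
  have hd1 : deriv (fun t => K / 16 * (δ ^ 2 * (1 - Real.cos (4 * (β + t)))
      + 4 * (δ * Real.cos (2 * β)) * (lam₁ + lam₂ + δ * Real.cos (2 * (β + t))))) =
      fun t => K / 16 * (δ ^ 2 * (4 * Real.sin (4 * (β + t)))
      + 4 * (δ * Real.cos (2 * β)) * (δ * (-2 * Real.sin (2 * (β + t))))) := by
    funext t
    have h := (((((harg 4 t).cos.const_sub 1).const_mul (δ ^ 2)).add
      ((((harg 2 t).cos.const_mul δ).const_add (lam₁ + lam₂)).const_mul
        (4 * (δ * Real.cos (2 * β))))).const_mul (K / 16))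
    refine h.deriv.trans ?_
    ring
  have hd2 : deriv (fun t => K / 16 * (δ ^ 2 * (4 * Real.sin (4 * (β + t)))
      + 4 * (δ * Real.cos (2 * β)) * (δ * (-2 * Real.sin (2 * (β + t)))))) 0 =
      K / 16 * (δ ^ 2 * (16 * Real.cos (4 * β))
        - 16 * δ ^ 2 * Real.cos (2 * β) * Real.cos (2 * β)) := by
    have h := (((((harg 4 0).sin.const_mul 4).const_mul (δ ^ 2)).add
      ((((harg 2 0).sin.const_mul (-2)).const_mul δ).const_mul
        (4 * (δ * Real.cos (2 * β))))).const_mul (K / 16))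
    refine h.deriv.trans ?_
    simp only [add_zero]
    ring
  rw [iteratedDeriv_succ, iteratedDeriv_one, hd1, hd2]
  have h4 : Real.cos (4 * β) = 2 * Real.cos (2 * β) ^ 2 - 1 := by
    rw [← Real.cos_two_mul]; congr 1; ring
  have hsin : 0 < Real.sin (2 * β) := by rw [Real.sin_two_mul]; positivity
  have hδ0 : 0 < δ ^ 2 := by
    have := sub_ne_zero.2 hne.symm
    positivity
  have hpos : 0 < K * (δ ^ 2 * Real.sin (2 * β) ^ 2) := by positivity
  rw [h4]
  have := Real.sin_sq_add_cos_sq (2 * β)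
  have hs2 : Real.sin (2 * β) ^ 2 = 1 - Real.cos (2 * β) ^ 2 := by linarith
  rw [hs2] at hpos
  linarith

end Join

/-! ### Restrictions of harmonic homogeneous polynomials -/

lemma hasFDerivAt_eval (P : MvPolynomial (Fin (m + 1)) ℝ) (z : Euc m) :
    HasFDerivAt (fun z : Euc m => MvPolynomial.eval (fun i => z i) P)
      (∑ i, MvPolynomial.eval (fun i => z i) (MvPolynomial.pderiv i P) •
        EuclideanSpace.proj (𝕜 := ℝ) i) z := by
  induction P using MvPolynomial.induction_on with
  | C a => simpa using hasFDerivAt_const a z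
  | add p q hp hq =>
    simp only [map_add, add_smul, Finset.sum_add_distrib]
    exact hp.add hq
  | mul_X p j hp =>
    have hj : HasFDerivAt (fun z : Euc m => z j) (EuclideanSpace.proj (𝕜 := ℝ) j) z :=
      (EuclideanSpace.proj (𝕜 := ℝ) j : Euc m →L[ℝ] ℝ).hasFDerivAt
    simp only [map_mul, MvPolynomial.eval_X]
    refine (hp.mul hj).congr_fderiv ?_
    have hX : ∀ i, MvPolynomial.eval (fun i => z i)
        (MvPolynomial.pderiv i (MvPolynomial.X j : MvPolynomial (Fin (m + 1)) ℝ)) =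
          if j = i then 1 else 0 := by
      intro i
      rw [MvPolynomial.pderiv_X, Pi.single_apply]
      split_ifs <;> simp
    simp only [Derivation.leibniz, map_add, smul_eq_mul, map_mul, MvPolynomial.eval_X, hX, add_smul,
      Finset.sum_add_distrib, mul_smul, Finset.smul_sum, ite_smul, one_smul, zero_smul, smul_ite,
      smul_zero, Finset.sum_ite_eq, Finset.mem_univ, if_true]

lemma contDiff_eval (P : MvPolynomial (Fin (m + 1)) ℝ) {k : ℕ∞ω} :
    ContDiff ℝ k (fun z : Euc m => MvPolynomial.eval (fun i => z i) P) :=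
  AnalyticOnNhd.contDiff (AnalyticOnNhd.eval_continuousLinearMap'
    (fun i => (EuclideanSpace.proj (𝕜 := ℝ) i : Euc m →L[ℝ] ℝ)) P)

lemma sum_mul_eval_pderiv {P : MvPolynomial (Fin (m + 1)) ℝ} {k : ℕ} (hP : P.IsHomogeneous k)
    (z : Euc m) :
    ∑ i, z i * MvPolynomial.eval (fun i => z i) (MvPolynomial.pderiv i P) =
      k * MvPolynomial.eval (fun i => z i) P := by
  have h := congrArg (MvPolynomial.eval fun i => z i) hP.sum_X_mul_pderiv
  simpa using h

/-- On a tangent vector `x`, the Hessian of the restriction of `P` is the Euclidean Hessian minus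
`|x|²` times the radial derivative, and the latter is `k P` by Euler's identity. -/
lemma hess_eval {P : MvPolynomial (Fin (m + 1)) ℝ} {k : ℕ} (hP : P.IsHomogeneous k)
    {p : USphere (Euc m)} {x : Euc m} (hx : inner ℝ (p : Euc m) x = 0) :
    hess (fun q => MvPolynomial.eval (fun i => (q : Euc m) i) P) p x x =
      (∑ i, ∑ j, MvPolynomial.eval (fun i => (p : Euc m) i)
        (MvPolynomial.pderiv j (MvPolynomial.pderiv i P)) * (x i * x j))
      - (k * MvPolynomial.eval (fun i => (p : Euc m) i) P) * inner ℝ x x := by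
  rw [hess_of_inner_eq_zero _ _ hx]
  have hext : ∀ q : USphere (Euc m),
      dirDeriv (fun q => MvPolynomial.eval (fun i => (q : Euc m) i) P) q (tangField x q) =
        (fun z : Euc m => ∑ i, MvPolynomial.eval (fun i => z i) (MvPolynomial.pderiv i P) * x i
          - inner ℝ z x * (k * MvPolynomial.eval (fun i => z i) P)) q := by
    intro q
    rw [dirDeriv_of_extension (hasFDerivAt_eval P q) (fun _ => rfl), tangField, tangProj_tangProj]
    simp only [← sum_mul_eval_pderiv hP (q : Euc m), Finset.mul_sum, ← Finset.sum_sub_distrib,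
      _root_.sum_apply, tangProj]
    refine Finset.sum_congr rfl fun i _ => ?_
    simp
    ring
  have h1 : HasFDerivAt (fun w : Euc m => inner ℝ w x) (innerSL ℝ x) (p : Euc m) := by
    simpa [real_inner_comm] using (innerSL ℝ x).hasFDerivAt (x := (p : Euc m))
  have hd := (HasFDerivAt.fun_sum (u := Finset.univ) fun i _ =>
    (hasFDerivAt_eval (MvPolynomial.pderiv i P) (p : Euc m)).mul_const (x i)).sub
    (h1.mul ((hasFDerivAt_eval P (p : Euc m)).const_mul (k : ℝ)))
  rw [dirDeriv_of_extension hd hext, tangProj_of_inner_eq_zero hx]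
  simp [hx, Finset.mul_sum, mul_comm, mul_assoc]

lemma laplaceBeltrami_eval {P : MvPolynomial (Fin (m + 1)) ℝ} {k : ℕ} (hP : P.IsHomogeneous k)
    (hharm : ∑ i, MvPolynomial.pderiv i (MvPolynomial.pderiv i P) = 0) (p : USphere (Euc m)) :
    laplaceBeltrami (fun q => MvPolynomial.eval (fun i => (q : Euc m) i) P) p =
      -((k : ℝ) * ((k : ℝ) + m - 1)) * MvPolynomial.eval (fun i => (p : Euc m) i) P := by
  set e : MvPolynomial (Fin (m + 1)) ℝ →+* ℝ := MvPolynomial.eval (fun i => (p : Euc m) i) with he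
  have hcoord : ∀ (x : Euc m) (i : Fin (m + 1)),
      inner ℝ (EuclideanSpace.single i (1 : ℝ) : Euc m) x = x i := by
    intro x i
    simp [EuclideanSpace.inner_single_left]
  have hcoord' : ∀ (x : Euc m) (i : Fin (m + 1)),
      inner ℝ x (EuclideanSpace.single i (1 : ℝ) : Euc m) = x i := fun x i => by
    rw [real_inner_comm, hcoord]
  have htr : ∀ i j, tr p (fun x y : Euc m => x i * y j) =
      (if i = j then 1 else 0) - (p : Euc m) i * (p : Euc m) j := by
    intro i j
    have h := tr_inner_mul_inner p (EuclideanSpace.single i (1 : ℝ) : Euc m)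
      (EuclideanSpace.single j (1 : ℝ))
    simp only [hcoord, hcoord'] at h
    rw [h]
    simp
  have h1 : laplaceBeltrami (fun q => MvPolynomial.eval (fun i => (q : Euc m) i) P) p =
      tr p (fun x y =>
        (∑ i, ∑ j, e (MvPolynomial.pderiv j (MvPolynomial.pderiv i P)) • (x i * y j)) + (-(k * e P)) • inner ℝ x y) := by
    refine tr_congr fun x hx => ?_
    rw [hess_eval hP hx]
    simp [he, sub_eq_add_neg]
  have h2 : tr p (fun x y : Euc m => ∑ i, ∑ j,
      e (MvPolynomial.pderiv j (MvPolynomial.pderiv i P)) • (x i * y j)) =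
      ∑ i, ∑ j, e (MvPolynomial.pderiv j (MvPolynomial.pderiv i P)) *
        ((if i = j then 1 else 0) - (p : Euc m) i * (p : Euc m) j) := by
    simp only [← htr, ← smul_eq_mul (a := e _), ← tr_smul]
    simp only [tr]
    rw [Finset.sum_comm]
    exact Finset.sum_congr rfl fun i _ => Finset.sum_comm
  have h3 : ∑ i, e (MvPolynomial.pderiv i (MvPolynomial.pderiv i P)) = 0 := by
    have := congrArg (MvPolynomial.eval (fun i => (p : Euc m) i)) hharm
    simpa using this
  -- Truncated subtraction is harmless: the factor `k` kills the case `k = 0`.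
  have hk : (k : ℝ) * ((k - 1 : ℕ) : ℝ) = k * (k - 1) := by
    cases k <;> simp
  have h4 : ∑ i, ∑ j, e (MvPolynomial.pderiv j (MvPolynomial.pderiv i P)) *
      ((p : Euc m) i * (p : Euc m) j) = k * (k - 1) * e P := by
    have h5 : ∀ i, ∑ j, e (MvPolynomial.pderiv j (MvPolynomial.pderiv i P)) *
        ((p : Euc m) i * (p : Euc m) j) =
        ((k - 1 : ℕ) : ℝ) * ((p : Euc m) i * e (MvPolynomial.pderiv i P)) := by
      intro i
      have h := sum_mul_eval_pderiv (hP.pderiv (i := i)) (p : Euc m)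
      calc _ = (p : Euc m) i * ∑ j, (p : Euc m) j *
            e (MvPolynomial.pderiv j (MvPolynomial.pderiv i P)) := by
            rw [Finset.mul_sum]
            exact Finset.sum_congr rfl fun j _ => by ring
        _ = _ := by rw [h]; ring
    rw [Finset.sum_congr rfl fun i _ => h5 i, ← Finset.mul_sum, sum_mul_eval_pderiv hP, ← hk]
    ring
  rw [h1, tr_add, tr_smul, tr_inner_self (finrank_euc m), h2]
  simp only [mul_sub, Finset.sum_sub_distrib, h4]
  simp only [mul_ite, mul_one, mul_zero, Finset.sum_ite_eq, Finset.mem_univ, if_true, h3]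
  simp
  ring

lemma IsEigenmapOfDegree.isSmooth {k : ℕ} {v : USphere (Euc m) → USphere (Euc n)}
    (h : IsEigenmapOfDegree k v) : IsSmooth v := by
  obtain ⟨P, -, -, hv⟩ := h
  have : Fact (Module.finrank ℝ (Euc m) = m + 1) := ⟨finrank_euc m⟩
  have hd : ContDiff ℝ ∞ (fun z : Euc m =>
      (WithLp.toLp 2 fun j => MvPolynomial.eval (fun i => z i) (P j) : Euc n)) :=
    contDiff_euclidean.2 fun j => contDiff_eval (P j)
  refine (hd.contMDiff.comp (contMDiff_coe_sphere (n := m))).congr fun p => ?_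
  ext j
  exact hv p j

lemma IsEigenmapOfDegree.laplaceBeltrami_eq {k : ℕ} {v : USphere (Euc m) → USphere (Euc n)}
    (h : IsEigenmapOfDegree k v) (p : USphere (Euc m)) :
    laplaceBeltrami (fun q => (v q : Euc n)) p =
      (-((k : ℝ) * ((k : ℝ) + m - 1))) • (v p : Euc n) := by
  have hs := h.isSmooth
  obtain ⟨P, hP, hharm, hv⟩ := h
  ext j
  rw [← laplaceBeltrami_apply hs.isC2]
  simp only [hv, laplaceBeltrami_eval (hP j) (hharm j) p, PiLp.smul_apply, smul_eq_mul]

/-! ### Existence of the angle -/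

lemma exists_angle_iff (c : ℝ) :
    (∃ β ∈ Set.Ioo 0 (Real.pi / 2), Real.cos (2 * β) = c) ↔ |c| < 1 := by
  rw [abs_lt]
  constructor
  · rintro ⟨β, ⟨h0, h1⟩, rfl⟩
    constructor
    · rw [← Real.cos_pi]
      exact Real.cos_lt_cos_of_nonneg_of_le_pi (by linarith) le_rfl (by linarith)
    · rw [← Real.cos_zero]
      exact Real.cos_lt_cos_of_nonneg_of_le_pi le_rfl (by linarith) (by linarith)
  · rintro ⟨h0, h1⟩
    have h2 := Real.arccos_pos.2 h1
    have h3 : Real.arccos c < Real.pi := lt_of_le_of_ne (Real.arccos_le_pi c) fun h =>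
      absurd (Real.arccos_eq_pi.1 h) (not_le.2 h0)
    refine ⟨Real.arccos c / 2, ⟨by linarith, by linarith⟩, ?_⟩
    rw [mul_div_cancel₀ _ two_ne_zero, Real.cos_arccos h0.le h1.le]

lemma abs_eigenvalue_sub (k₁ k₂ m : ℕ) (hm : 1 ≤ m) :
    |(k₂ : ℝ) * ((k₂ : ℝ) + m - 1) - (k₁ : ℝ) * ((k₁ : ℝ) + m - 1)| =
      |(k₁ : ℝ) - k₂| * ((k₁ : ℝ) + k₂ + m - 1) := by
  have hm' : (1 : ℝ) ≤ m := by exact_mod_cast hm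
  have hpos : 0 ≤ (k₁ : ℝ) + k₂ + m - 1 := by
    have := Nat.cast_nonneg (α := ℝ) k₁
    have := Nat.cast_nonneg (α := ℝ) k₂
    linarith
  conv_rhs => rw [← abs_of_nonneg hpos, ← abs_mul, ← abs_neg]
  congr 1
  ring

lemma le_abs_eigenvalue_sub {k₁ k₂ m : ℕ} (hm : 1 ≤ m) (hk : k₁ ≠ k₂) :
    (m : ℝ) ≤ |(k₁ : ℝ) - k₂| * ((k₁ : ℝ) + k₂ + m - 1) := by
  have hm' : (1 : ℝ) ≤ m := by exact_mod_cast hm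
  have h1 : (1 : ℝ) ≤ |(k₁ : ℝ) - k₂| := by
    have : (1 : ℤ) ≤ |(k₁ : ℤ) - k₂| := Int.one_le_abs (sub_ne_zero.2 (by exact_mod_cast hk))
    exact_mod_cast this
  have h2 : (1 : ℝ) ≤ (k₁ : ℝ) + k₂ := by
    have : 1 ≤ k₁ + k₂ := by omega
    exact_mod_cast this
  nlinarith

lemma abs_two_thirds_lt_iff {m : ℕ} (hm : 1 ≤ m) {D : ℝ} (hD : (m : ℝ) ≤ D) :
    |2 / 3 * ((m : ℝ) - 1) * ((m : ℝ) - 3)| < D ↔ 2 / 3 * ((m : ℝ) - 1) * ((m : ℝ) - 3) < D := by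
  -- The constant is negative only for `m = 2`, where it equals `-2/3`.
  have hlow : -D < 2 / 3 * ((m : ℝ) - 1) * ((m : ℝ) - 3) := by
    have hm' : (1 : ℝ) ≤ m := by exact_mod_cast hm
    nlinarith [sq_nonneg ((m : ℝ) - 2)]
  rw [abs_lt]
  exact and_iff_right hlow

end Maps

end SphereMaps

end

theorem theorem1p4 (m n : ℕ) (hm : 1 ≤ m) :
    -- eigenmaps are exactly the harmonic maps with constant `|∇v|²`
    (∀ v : SphereMaps.USphere (SphereMaps.Euc m) → SphereMaps.USphere (SphereMaps.Euc n),
      SphereMaps.IsEigenmap v ↔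
        SphereMaps.IsHarmonic v ∧ ∃ lam : ℝ, ∀ p, SphereMaps.gradSq v p = lam) ∧
    -- the construction
    (∀ (v₁ v₂ : SphereMaps.USphere (SphereMaps.Euc m) → SphereMaps.USphere (SphereMaps.Euc n))
      (lam₁ lam₂ β : ℝ),
      SphereMaps.IsEigenmap v₁ → SphereMaps.IsEigenmap v₂ →
      (∀ p, SphereMaps.gradSq v₁ p = lam₁) → (∀ p, SphereMaps.gradSq v₂ p = lam₂) →
      lam₁ ≠ lam₂ → β ∈ Set.Ioo 0 (Real.pi / 2) →
      Real.cos (2 * β) = 2 / 3 * ((m : ℝ) - 1) * ((m : ℝ) - 3) * (1 / (lam₂ - lam₁)) →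
      SphereMaps.IsConformalBiharmonic (SphereMaps.joinMap β v₁ v₂) ∧
        ¬ SphereMaps.IsHarmonic (SphereMaps.joinMap β v₁ v₂) ∧
        SphereMaps.IsUnstable (SphereMaps.joinMap β v₁ v₂)) ∧
    -- eigenmaps of degrees `k₁`, `k₂`
    (∀ (k₁ k₂ : ℕ)
      (v₁ v₂ : SphereMaps.USphere (SphereMaps.Euc m) → SphereMaps.USphere (SphereMaps.Euc n)),
      SphereMaps.IsEigenmapOfDegree k₁ v₁ → SphereMaps.IsEigenmapOfDegree k₂ v₂ →
      ∃ lam₁ lam₂ : ℝ,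
        lam₁ = (k₁ : ℝ) * ((k₁ : ℝ) + (m : ℝ) - 1) ∧
        lam₂ = (k₂ : ℝ) * ((k₂ : ℝ) + (m : ℝ) - 1) ∧
        SphereMaps.IsEigenmap v₁ ∧ (∀ p, SphereMaps.gradSq v₁ p = lam₁) ∧
        SphereMaps.IsEigenmap v₂ ∧ (∀ p, SphereMaps.gradSq v₂ p = lam₂) ∧
        (k₁ ≠ k₂ →
          lam₁ ≠ lam₂ ∧
          ((∃ β ∈ Set.Ioo 0 (Real.pi / 2),
              Real.cos (2 * β) =
                2 / 3 * ((m : ℝ) - 1) * ((m : ℝ) - 3) * (1 / (lam₂ - lam₁))) ↔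
            2 / 3 * ((m : ℝ) - 1) * ((m : ℝ) - 3) <
              |(k₁ : ℝ) - (k₂ : ℝ)| * ((k₁ : ℝ) + (k₂ : ℝ) + (m : ℝ) - 1)))) := by
  open SphereMaps in
  refine ⟨isEigenmap_iff_isHarmonic, ?_, ?_⟩
  · intro v₁ v₂ lam₁ lam₂ β hv₁ hv₂ hl₁ hl₂ hne hβ hcos
    have hs : 0 < Real.sin β := Real.sin_pos_of_pos_of_lt_pi hβ.1 (by linarith [hβ.2, Real.pi_pos])
    have hc : 0 < Real.cos β := Real.cos_pos_of_mem_Ioo ⟨by linarith [hβ.1, Real.pi_pos], hβ.2⟩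
    have hcos' : (lam₂ - lam₁) * Real.cos (2 * β) =
        2 / 3 * ((m : ℝ) - 1) * ((m : ℝ) - 3) := by
      have hδ : lam₂ - lam₁ ≠ 0 := sub_ne_zero.2 hne.symm
      rw [hcos]
      field_simp
    have e₁ := hv₁.laplaceBeltrami_eq hl₁
    have e₂ := hv₂.laplaceBeltrami_eq hl₂
    exact ⟨isConformalBiharmonic_joinMap hv₁.1 hv₂.1 e₁ e₂ hcos',
      not_isHarmonic_joinMap hv₁.1 hv₂.1 e₁ e₂ hne hs hc,
      isUnstable_joinMap hv₁.1 hv₂.1 e₁ e₂ hne hs hc hcos'⟩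
  · intro k₁ k₂ v₁ v₂ h₁ h₂
    have g : ∀ (k : ℕ) (v : USphere (Euc m) → USphere (Euc n)), IsEigenmapOfDegree k v →
        IsEigenmap v ∧ ∀ p, gradSq v p = (k : ℝ) * ((k : ℝ) + (m : ℝ) - 1) := fun k v h =>
      ⟨isEigenmap_iff.2 ⟨h.isSmooth, _, h.laplaceBeltrami_eq⟩, fun p => by
        rw [gradSq_of_laplaceBeltrami h.isSmooth.isC2 h.laplaceBeltrami_eq, neg_neg]⟩
    refine ⟨_, _, rfl, rfl, (g k₁ v₁ h₁).1, (g k₁ v₁ h₁).2, (g k₂ v₂ h₂).1, (g k₂ v₂ h₂).2,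
      fun hk => ?_⟩
    have hle := le_abs_eigenvalue_sub hm hk
    have hm' : (0 : ℝ) < m := by exact_mod_cast hm
    have habs := abs_eigenvalue_sub k₁ k₂ m hm
    have hpos := habs ▸ hm'.trans_le hle
    refine ⟨fun h => abs_pos.1 hpos (sub_eq_zero.2 h.symm), ?_⟩
    rw [exists_angle_iff, mul_one_div, abs_div, div_lt_one hpos, habs,
      abs_two_thirds_lt_iff hm hle]
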